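/- Fix a countable set $V$ of propositional variables. Let $\mathcal L_{\Box\Diamond}$ be the set of formulas built from $V$ with the constant $\bot$, the binary connectives $\wedge,\vee,\to$ and the unary operators $\Box,\Diamond$; put $\top:=\bot\to\bot$ and $\neg\varphi:=\varphi\to\bot$. The calculus $\mathcal{GK}^c$ has as axioms all instances in $\mathcal L_{\Box\Diamond}$ of the following schemes. (i) Propositional Gödel logic: $\varphi\to(\psi\to\varphi)$; $(\varphi\wedge\psi)\to\varphi$; $(\varphi\wedge\psi)\to\psi$; $\varphi\to(\psi\to(\varphi\wedge\psi))$; $(\bot\to\varphi)\wedge(\varphi\to\top)$; $\varphi\to(\varphi\vee\psi)$; $\psi\to(\varphi\vee\psi)$; $(\varphi\to\psi)\to((\chi\to\varphi)\to(\chi\to\psi))$; $(\varphi\to(\psi\to\chi))\to(\psi\to(\varphi\to\chi))$; $((\varphi\to\chi)\wedge(\psi\to\chi))\to((\varphi\vee\psi)\to\chi)$; $(\varphi\to(\psi\to\chi))\to((\varphi\wedge\psi)\to\chi)$; $((\chi\to\varphi)\wedge(\chi\to\psi))\to(\chi\to(\varphi\wedge\psi))$; $(\varphi\to(\varphi\to\psi))\to(\varphi\to\psi)$;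 $(\varphi\to\psi)\vee(\psi\to\varphi)$. (ii) Modal axioms: $\Box(\varphi\to\psi)\to(\Box\varphi\to\Box\psi)$; $\Diamond(\varphi\vee\psi)\to(\Diamond\varphi\vee\Diamond\psi)$; $\Diamond(\varphi\to\psi)\to(\Box\varphi\to\Diamond\psi)$; $(\Diamond\varphi\to\Box\psi)\to\Box(\varphi\to\psi)$; $\neg\Diamond\bot$; $\Box(\varphi\vee\psi)\to(\Box\varphi\vee\Diamond\psi)$. Its rules are modus ponens and, applied to theorems only, $\vdash\varphi\Rightarrow\ \vdash\Box\varphi$ and $\vdash\varphi\to\psi\Rightarrow\ \vdash\Diamond\varphi\to\Diamond\psi$. Write $\vdash_{\mathcal{GK}^c}\varphi$ if $\varphi$ is derivable from the empty set of premises. A crisp Gödel–Kripke model is a triple $\langle W,R,e\rangle$ with $W\neq\emptyset$, $R\colon W\times W\to\{0,1\}$ and $e\colon V\times W\to[0,1]$. The evaluation is extended to all formulas by $$e(x,\bot)=0,\quad e(x,\varphi\wedge\psi)=\min(e(x,\varphi),e(x,\psi)),\quad e(x,\varphi\vee\psi)=\max(e(x,\varphi),e(x,\psi)),$$ $$e(x,\varphi\to\psi)=e(x,\varphi)\Rightarrow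 e(x,\psi),\quad e(x,\Box\varphi)=\inf_{y\in W}\bigl(R(x,y)\Rightarrow e(y,\varphi)\bigr),\quad e(x,\Diamond\varphi)=\sup_{y\in W}\min\bigl(R(x,y),e(y,\varphi)\bigr),$$ where $a\Rightarrow b=1$ if $a\le b$ and $a\Rightarrow b=b$ otherwise. Write $\models_{\mathbf{GK}^c}\varphi$ if $e(x,\varphi)=1$ for every crisp Gödel–Kripke model and every world $x$ of it. **Theorem (Weak completeness).** For every formula $\varphi\in\mathcal L_{\Box\Diamond}$, $$\vdash_{\mathcal{GK}^c}\varphi\quad\text{if and only if}\quad\models_{\mathbf{GK}^c}\varphi.$$ -/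

import Mathlib

universe u v

namespace GodelModal

/-- Bimodal formulas over the set `V` of propositional variables, with primitive symbols
`⊥`, `∧`, `∨`, `→`, `□`, `◇`. -/
inductive Formula (V : Type u) : Type u
  | var : V → Formula V
  | bot : Formula V
  | and : Formula V → Formula V → Formula V
  | or : Formula V → Formula V → Formula V
  | imp : Formula V → Formula V → Formula V
  | box : Formula V → Formula V
  | dia : Formula V → Formula V

namespace Formula

/-- `⊤ := ⊥ → ⊥`. -/
def top {V : Type u} : Formula V := imp bot bot

/-- `¬ φ := φ → ⊥`. -/
def neg {V : Type u} (φ : Formula V) : Formula V := imp φ bot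

end Formula

open Formula

/-- The axiom schemes of propositional Gödel logic, instantiated with bimodal formulas. -/
inductive GodelAxiom {V : Type u} : Formula V → Prop
  | A1 (φ ψ : Formula V) : GodelAxiom (imp φ (imp ψ φ))
  | A2 (φ ψ : Formula V) : GodelAxiom (imp (and φ ψ) φ)
  | A3 (φ ψ : Formula V) : GodelAxiom (imp (and φ ψ) ψ)
  | A4 (φ ψ : Formula V) : GodelAxiom (imp φ (imp ψ (and φ ψ)))
  | A5 (φ : Formula V) : GodelAxiom (and (imp bot φ) (imp φ top))
  | A6 (φ ψ : Formula V) : GodelAxiom (imp φ (or φ ψ))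
  | A7 (φ ψ : Formula V) : GodelAxiom (imp ψ (or φ ψ))
  | A8 (φ ψ χ : Formula V) :
      GodelAxiom (imp (imp φ ψ) (imp (imp χ φ) (imp χ ψ)))
  | A9 (φ ψ χ : Formula V) :
      GodelAxiom (imp (imp φ (imp ψ χ)) (imp ψ (imp φ χ)))
  | A10 (φ ψ χ : Formula V) :
      GodelAxiom (imp (and (imp φ χ) (imp ψ χ)) (imp (or φ ψ) χ))
  | A11 (φ ψ χ : Formula V) :
      GodelAxiom (imp (imp φ (imp ψ χ)) (imp (and φ ψ) χ))
  | A12 (φ ψ χ : Formula V) :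
      GodelAxiom (imp (and (imp χ φ) (imp χ ψ)) (imp χ (and φ ψ)))
  | A13 (φ ψ : Formula V) :
      GodelAxiom (imp (imp φ (imp φ ψ)) (imp φ ψ))
  | A14 (φ ψ : Formula V) : GodelAxiom (or (imp φ ψ) (imp ψ φ))

/-- The modal axiom schemes of `GK`. -/
inductive GKAxiom {V : Type u} : Formula V → Prop
  | KBox (φ ψ : Formula V) : GKAxiom (imp (box (imp φ ψ)) (imp (box φ) (box ψ)))
  | KDia (φ ψ : Formula V) : GKAxiom (imp (dia (or φ ψ)) (or (dia φ) (dia ψ)))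
  | FS1 (φ ψ : Formula V) : GKAxiom (imp (dia (imp φ ψ)) (imp (box φ) (dia ψ)))
  | FS2 (φ ψ : Formula V) : GKAxiom (imp (imp (dia φ) (box ψ)) (box (imp φ ψ)))
  | FDia : GKAxiom (neg (dia bot))

/-- `GKcDerivable Γ φ` is `Γ ⊢ φ` in the calculus `GKᶜ`: the axioms of Gödel logic, those of
`GK`, the scheme `Cr`, modus ponens, and the two modal rules, which apply to theorems
(formulas derivable from the empty set) only. -/
inductive GKcDerivable {V : Type u} : Set (Formula V) → Formula V → Prop
  | hyp {Γ : Set (Formula V)} {φ : Formula V} : φ ∈ Γ → GKcDerivable Γ φ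
  | godel {Γ : Set (Formula V)} {φ : Formula V} : GodelAxiom φ → GKcDerivable Γ φ
  | gk {Γ : Set (Formula V)} {φ : Formula V} : GKAxiom φ → GKcDerivable Γ φ
  | cr {Γ : Set (Formula V)} (φ ψ : Formula V) :
      GKcDerivable Γ (imp (box (or φ ψ)) (or (box φ) (dia ψ)))
  | mp {Γ : Set (Formula V)} {φ ψ : Formula V} :
      GKcDerivable Γ φ → GKcDerivable Γ (imp φ ψ) → GKcDerivable Γ ψ
  | necBox {Γ : Set (Formula V)} {φ : Formula V} :
      GKcDerivable ∅ φ → GKcDerivable Γ (box φ)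
  | necDia {Γ : Set (Formula V)} {φ ψ : Formula V} :
      GKcDerivable ∅ (imp φ ψ) → GKcDerivable Γ (imp (dia φ) (dia ψ))

/-- The implication of the standard Gödel algebra on `[0,1]`. -/
noncomputable def godelImp (a b : unitInterval) : unitInterval := if a ≤ b then 1 else b

/-- Gödel–Kripke models over the variables `V`. -/
structure GKModel (V : Type u) : Type (max u (v + 1)) where
  /-- the set of worlds -/
  W : Type v
  nonempty : Nonempty W
  /-- the accessibility relation -/
  R : W → W → unitInterval
  /-- the evaluation of the variables -/
  e : V → W → unitInterval

namespace GKModel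

/-- The accessibility relation takes only the values `0` and `1`. -/
def IsCrisp {V : Type u} (M : GKModel.{u, v} V) : Prop :=
  ∀ x y : M.W, M.R x y = 0 ∨ M.R x y = 1

/-- The evaluation of formulas at the worlds of a model. -/
noncomputable def eval {V : Type u} (M : GKModel.{u, v} V) :
    M.W → Formula V → unitInterval
  | x, .var p => M.e p x
  | _, .bot => 0
  | x, .and φ ψ => min (M.eval x φ) (M.eval x ψ)
  | x, .or φ ψ => max (M.eval x φ) (M.eval x ψ)
  | x, .imp φ ψ => godelImp (M.eval x φ) (M.eval x ψ)
  | x, .box φ => ⨅ y : M.W, godelImp (M.R x y) (M.eval y φ)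
  | x, .dia φ => ⨆ y : M.W, min (M.R x y) (M.eval y φ)

end GKModel

/-- Local consequence over the crisp Gödel–Kripke models whose worlds form a type in the
universe `v`. -/
def CrispConsequence {V : Type u} (Γ : Set (Formula V)) (φ : Formula V) : Prop :=
  ∀ M : GKModel.{u, v} V, M.IsCrisp →
    ∀ x : M.W, (∀ γ ∈ Γ, M.eval x γ = 1) → M.eval x φ = 1

end GodelModal

/-!
Soundness is an induction on derivations, using that in a crisp model the value of `□φ` is the
infimum, and that of `◇φ` the supremum, of the values of `φ` at the successors.

For completeness, an underivable formula `φ` is refuted in a canonical model over a finite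
fragment `S` of formulas containing `φ`. A prime theory `T` (closed under modus ponens, containing
all theorems) linearly preorders the formulas by `α ≼ β` iff `α → β ∈ T`. A world is a valuation
`e` in `[0,1]` that realizes on `S` the order of some prime theory (`Realizes`), and `f` is
accessible from `e` when `e (□ψ) ≤ f ψ ≤ e (◇ψ)` for all `□ψ`, `◇ψ` in `S`. The propositional
cases of the truth lemma are immediate. The modal cases need, for a world `e` with theory `T` and
a value `β > e (□φ)`, an accessible `f` with `f φ ≤ β`, and dually for `◇φ`. This takes two steps.

* Syntactically, there is a prime theory `G` with `□⁻¹ T ⊆ G ⊆ ◇⁻¹ T` in which `θ ≼ φ` only if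
  `□θ ≼ □φ` holds in `T` (`IsPrimeTheory.exists_isSuccessor_box`). It comes from the prime theory
  theorem; the scheme `□(α ∨ γ) → □α ∨ ◇γ` of crisp frames makes it possible to omit the unwanted
  implications and the formulas outside `◇⁻¹ T` simultaneously.
* Numerically, the finite order of `G` on `S` has to be realized between the lower bounds `e (□ψ)`
  and the upper bounds `e (◇ψ)`, with `β` as one more upper bound at `φ`. A finite total preorder
  can be embedded between bounds in a dense order when the bounds are weakly compatible with `≼`
  and strictly compatible with its strict part (`exists_orderEmbedding_between`); weak
  compatibility is the scheme `◇(α → β) → (□α → ◇β)` and strict compatibility is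
  `(◇α → □β) → □(α → β)`.

A world is determined by finitely many values, so the model can be placed in any universe.
-/

namespace GodelModal

open Formula

/-! ### Soundness -/

section Soundness

theorem godelImp_eq_one {a b : unitInterval} : godelImp a b = 1 ↔ a ≤ b := by
  unfold godelImp
  split_ifs with h
  · simp [h]
  · simp only [h, iff_false]
    rintro rfl
    exact h unitInterval.le_one'

theorem le_godelImp {a b c : unitInterval} : a ≤ godelImp b c ↔ min a b ≤ c := by
  unfold godelImp
  split_ifs with h
  · simp [unitInterval.le_one', h]
  · simp [h]

theorem godelImp_one_left (b : unitInterval) : godelImp 1 b = b := by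
  unfold godelImp
  split_ifs with h
  · exact le_antisymm h unitInterval.le_one'
  · rfl

theorem godelImp_zero_left (b : unitInterval) : godelImp 0 b = 1 :=
  godelImp_eq_one.2 unitInterval.nonneg'

variable {V : Type u} {M : GKModel.{u, v} V}

theorem GKModel.IsCrisp.le_eval_box (hM : M.IsCrisp) {a : unitInterval} {x : M.W}
    {φ : Formula V} :
    a ≤ M.eval x (box φ) ↔ ∀ y, M.R x y = 1 → a ≤ M.eval y φ := by
  simp only [GKModel.eval, le_iInf_iff]
  refine forall_congr' fun y => ?_
  rcases hM x y with h | h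
  · simp [h, godelImp_zero_left, unitInterval.le_one']
  · simp [h, godelImp_one_left]

theorem GKModel.IsCrisp.eval_dia_le (hM : M.IsCrisp) {a : unitInterval} {x : M.W}
    {φ : Formula V} :
    M.eval x (dia φ) ≤ a ↔ ∀ y, M.R x y = 1 → M.eval y φ ≤ a := by
  simp only [GKModel.eval, iSup_le_iff]
  refine forall_congr' fun y => ?_
  rcases hM x y with h | h
  · simp [h]
  · simp [h, unitInterval.le_one']

theorem GodelAxiom.eval_eq_one {φ : Formula V} (h : GodelAxiom φ) (x : M.W) :
    M.eval x φ = 1 := by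
  have h1 (a : unitInterval) : a ≤ 1 := unitInterval.le_one'
  have h0 (a : unitInterval) : 0 ≤ a := unitInterval.nonneg'
  cases h with
  | A14 φ ψ =>
    rcases le_total (M.eval x φ) (M.eval x ψ) with h | h
    · simp [GKModel.eval, godelImp_eq_one.2 h, h1]
    · simp [GKModel.eval, godelImp_eq_one.2 h, h1]
  | _ => simp only [GKModel.eval, top]; grind [godelImp]

theorem GKAxiom.eval_eq_one {φ : Formula V} (h : GKAxiom φ) (hM : M.IsCrisp) (x : M.W) :
    M.eval x φ = 1 := by
  have hbox {φ : Formula V} {x y} (h : M.R x y = 1) : M.eval x (box φ) ≤ M.eval y φ :=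
    hM.le_eval_box.1 le_rfl y h
  have hdia {φ : Formula V} {x y} (h : M.R x y = 1) : M.eval y φ ≤ M.eval x (dia φ) :=
    hM.eval_dia_le.1 le_rfl y h
  have himp {a b c : unitInterval} (h : a ≤ godelImp b c) (h' : a ≤ b) : a ≤ c := by
    rwa [le_godelImp, min_eq_left h'] at h
  cases h with
  | KBox φ ψ =>
    rw [GKModel.eval, godelImp_eq_one, GKModel.eval, le_godelImp, hM.le_eval_box]
    intro y hy
    exact himp ((min_le_left _ _).trans (hbox hy)) ((min_le_right _ _).trans (hbox hy))
  | KDia φ ψ =>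
    rw [GKModel.eval, godelImp_eq_one, hM.eval_dia_le]
    intro y hy
    exact max_le_max (hdia hy) (hdia hy)
  | FS1 φ ψ =>
    rw [GKModel.eval, godelImp_eq_one, hM.eval_dia_le]
    intro y hy
    rw [GKModel.eval, GKModel.eval, le_godelImp]
    exact (himp (min_le_left _ _) ((min_le_right _ _).trans (hbox hy))).trans (hdia hy)
  | FS2 φ ψ =>
    rw [GKModel.eval, godelImp_eq_one, hM.le_eval_box]
    intro y hy
    rw [GKModel.eval, GKModel.eval, le_godelImp]
    exact (himp (min_le_left _ _) ((min_le_right _ _).trans (hdia hy))).trans (hbox hy)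
  | FDia =>
    rw [neg, GKModel.eval, godelImp_eq_one, hM.eval_dia_le]
    intro y _
    exact le_rfl

/-- Soundness: every rule of the calculus preserves validity in the crisp models. -/
theorem GKcDerivable.crispConsequence {Γ : Set (Formula V)} {φ : Formula V}
    (h : GKcDerivable Γ φ) : CrispConsequence.{u, v} Γ φ := by
  induction h with
  | hyp h => exact fun M _ x hx => hx _ h
  | godel h => exact fun M _ x _ => h.eval_eq_one x
  | gk h => exact fun M hM x _ => h.eval_eq_one hM x
  | cr φ ψ =>
    intro M hM x _
    rw [GKModel.eval, godelImp_eq_one, GKModel.eval, le_max_iff, or_iff_not_imp_right, not_le,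
      hM.le_eval_box]
    intro hlt y hy
    have h₁ : M.eval x (box (or φ ψ)) ≤ max (M.eval y φ) (M.eval y ψ) :=
      hM.le_eval_box.1 le_rfl y hy
    have h₂ : M.eval y ψ ≤ M.eval x (dia ψ) := hM.eval_dia_le.1 le_rfl y hy
    exact (le_max_iff.1 h₁).resolve_right (h₂.trans_lt hlt).not_ge
  | mp _ _ ih₁ ih₂ =>
    intro M hM x hx
    have h := ih₂ M hM x hx
    rw [GKModel.eval, godelImp_eq_one, ih₁ M hM x hx] at h
    exact le_antisymm unitInterval.le_one' h
  | necBox _ ih =>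
    intro M hM x _
    refine le_antisymm unitInterval.le_one' (hM.le_eval_box.2 fun y _ => ?_)
    exact (ih M hM y (by simp)).ge
  | necDia _ ih =>
    intro M hM x _
    rw [GKModel.eval, godelImp_eq_one, hM.eval_dia_le]
    intro y hy
    have h := ih M hM y (by simp)
    rw [GKModel.eval, godelImp_eq_one] at h
    exact h.trans (hM.eval_dia_le.1 le_rfl y hy)

end Soundness

/-! ### Interpolating a finite total preorder between two bounds -/

/-- A finite total preorder embeds in a dense bounded linear order between bounds `l` and `u`
as soon as `l a ≤ u b` whenever `a` is below `b`, with strict inequality whenever `a` is strictly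
below `b`. The bounds themselves need not be monotone. -/
theorem exists_orderEmbedding_between {α β : Type*} [Finite α] [LinearOrder β]
    [DenselyOrdered β] [BoundedOrder β] (r : α → α → Prop)
    (total : ∀ a b, r a b ∨ r b a) (trans : ∀ a b c, r a b → r b c → r a c) (l u : α → β)
    (hle : ∀ a b, r a b → l a ≤ u b) (hlt : ∀ a b, ¬ r b a → l a < u b) :
    ∃ e : α → β, (∀ a b, e a ≤ e b ↔ r a b) ∧ ∀ a, l a ≤ e a ∧ e a ≤ u a := by
  classical
  have := Fintype.ofFinite α
  have refl a : r a a := (total a a).elim id id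
  -- The rank function: the number of elements strictly below a point.
  let f : α → ℕ := fun a => (Finset.univ.filter fun t => ¬ r a t).card
  have hf a b (h : f a ≤ f b) : r a b := by
    by_contra hab
    refine h.not_gt (Finset.card_lt_card ?_)
    rw [Finset.ssubset_iff_of_subset]
    · exact ⟨b, by simpa using hab, by simpa using refl b⟩
    · intro t
      simp only [Finset.mem_filter, Finset.mem_univ, true_and]
      exact fun hbt hat => hbt (trans _ _ _ ((total a b).resolve_left hab) hat)
  -- The least monotone function above `l` and the greatest one below `u`.
  let L : α → β := fun a => (Finset.univ.filter fun t => r t a).sup l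
  let U : α → β := fun a => (Finset.univ.filter fun t => r a t).inf u
  have hL a : ∃ b, r b a ∧ L a = l b := by
    obtain ⟨b, hb, h⟩ := Finset.exists_mem_eq_sup (Finset.univ.filter fun t => r t a)
      ⟨a, by simpa using refl a⟩ l
    exact ⟨b, by simpa using hb, h⟩
  have hU a : ∃ b, r a b ∧ U a = u b := by
    obtain ⟨b, hb, h⟩ := Finset.exists_mem_eq_inf (Finset.univ.filter fun t => r a t)
      ⟨a, by simpa using refl a⟩ u
    exact ⟨b, by simpa using hb, h⟩
  have hlL a : l a ≤ L a := Finset.le_sup (f := l) (by simpa using refl a)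
  have hUu a : U a ≤ u a := Finset.inf_le (f := u) (by simpa using refl a)
  have hLmono a b (h : r a b) : L a ≤ L b := by
    refine Finset.sup_mono fun t => ?_
    simpa using fun ht => trans _ _ _ ht h
  have hUmono a b (h : r a b) : U a ≤ U b := by
    refine Finset.inf_mono fun t => ?_
    simpa using fun ht => trans _ _ _ h ht
  have hLU a : L a ≤ U a := by
    obtain ⟨b, hb, h⟩ := hL a
    obtain ⟨c, hc, h'⟩ := hU a
    rw [h, h']
    exact hle _ _ (trans _ _ _ hb hc)
  have hLU' a b (hab : ¬ r b a) : L a < U b := by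
    obtain ⟨a', ha, h⟩ := hL a
    obtain ⟨b', hb, h'⟩ := hU b
    rw [h, h']
    exact hlt _ _ fun h => hab (trans _ _ _ hb (trans _ _ _ h ha))
  -- The values are chosen in ascending order; the last clause of the induction hypothesis keeps
  -- room below the upper bounds of the points still to come.
  have key (s : Finset α) : ∃ e : α → β, (∀ a ∈ s, ∀ b ∈ s, e a ≤ e b ↔ r a b) ∧
      ∀ a ∈ s, L a ≤ e a ∧ e a ≤ U a ∧ ∀ c, ¬ r c a → e a < U c := by
    induction s using Finset.induction_on_max_value f with
    | empty => exact ⟨fun _ => ⊥, by simp⟩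
    | insert b s hbs hmax ih =>
      obtain ⟨e, he, hb⟩ := ih
      have hsb a (ha : a ∈ s) : r a b := hf _ _ (hmax a ha)
      have hne a (ha : a ∈ s) : a ≠ b := fun h => hbs (h ▸ ha)
      suffices ∃ x, (∀ a ∈ s, e a ≤ x ∧ (x ≤ e a ↔ r b a)) ∧ L b ≤ x ∧ x ≤ U b ∧
          ∀ c, ¬ r c b → x < U c by
        obtain ⟨x, hx, hx'⟩ := this
        refine ⟨Function.update e b x, ?_, ?_⟩
        · intro a ha c hc
          rcases Finset.mem_insert.1 ha with hab | ha' <;>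
            rcases Finset.mem_insert.1 hc with hcb | hc'
          · simp [hab, hcb, refl]
          · simpa [hab, hne _ hc'] using (hx c hc').2
          · simpa [hcb, hne _ ha', hsb _ ha'] using (hx a ha').1
          · simpa [hne _ ha', hne _ hc'] using he a ha' c hc'
        · intro a ha
          rcases Finset.mem_insert.1 ha with rfl | ha
          · simpa using hx'
          · simpa [hne _ ha] using hb a ha
      by_cases hex : ∃ a ∈ s, r b a
      · obtain ⟨a, ha, hba⟩ := hex
        refine ⟨e a, fun c hc => ⟨(he c hc a ha).2 (trans _ _ _ (hsb c hc) hba), ?_⟩,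
          (hLmono _ _ hba).trans (hb a ha).1, (hb a ha).2.1.trans (hUmono _ _ (hsb a ha)),
          fun c hc => (hb a ha).2.2 c fun h => hc (trans _ _ _ h (hsb a ha))⟩
        rw [he a ha c hc]
        exact ⟨trans _ _ _ hba, trans _ _ _ (hsb a ha)⟩
      · push Not at hex
        suffices ∃ x, (∀ a ∈ s, e a < x) ∧ L b ≤ x ∧ x ≤ U b ∧ ∀ c, ¬ r c b → x < U c by
          obtain ⟨x, hx, hx'⟩ := this
          exact ⟨x, fun a ha => ⟨(hx a ha).le,
            iff_of_false (hx a ha).not_ge (hex a ha)⟩, hx'⟩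
        -- `L b` is the value, unless some value chosen before is not below it.
        by_cases hl : ∀ a ∈ s, e a < L b
        · exact ⟨L b, hl, le_rfl, hLU b, fun c hc => hLU' _ _ hc⟩
        · push Not at hl
          obtain ⟨a, ha, hab⟩ := hl
          obtain ⟨m, hm, hm'⟩ := Finset.exists_max_image s e ⟨a, ha⟩
          obtain ⟨x, hmx, hxU⟩ := exists_between ((hb m hm).2.2 b (hex m hm))
          exact ⟨x, fun c hc => (hm' c hc).trans_lt hmx, (hab.trans (hm' a ha)).trans hmx.le,
            hxU.le, fun c hc => hxU.trans_le (hUmono _ _ ((total b c).resolve_right hc))⟩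
  obtain ⟨e, he, hb⟩ := key Finset.univ
  exact ⟨e, fun a b => he a (Finset.mem_univ _) b (Finset.mem_univ _), fun a =>
    ⟨(hlL a).trans (hb a (Finset.mem_univ _)).1,
      (hb a (Finset.mem_univ _)).2.1.trans (hUu a)⟩⟩

/-! ### Theories and prime theories -/

variable {V : Type u}

/-- A theory: a set of formulas that contains the theorems of the calculus and is closed under
modus ponens (the modal rules act on theorems only). -/
structure IsTheory (T : Set (Formula V)) : Prop where
  thm : ∀ {φ}, GKcDerivable ∅ φ → φ ∈ T
  mp : ∀ {φ ψ}, φ ∈ T → imp φ ψ ∈ T → ψ ∈ T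

theorem isTheory_theorems : IsTheory {φ : Formula V | GKcDerivable ∅ φ} :=
  ⟨id, .mp⟩

namespace IsTheory

variable {T : Set (Formula V)} {φ ψ χ : Formula V}

theorem godel (hT : IsTheory T) (h : GodelAxiom φ) : φ ∈ T := hT.thm (.godel h)

theorem gk (hT : IsTheory T) (h : GKAxiom φ) : φ ∈ T := hT.thm (.gk h)

theorem imp_of_mem (hT : IsTheory T) (h : ψ ∈ T) : imp φ ψ ∈ T := hT.mp h (hT.godel (.A1 _ _))

theorem imp_self (hT : IsTheory T) : imp φ φ ∈ T :=
  hT.mp (hT.godel (.A1 φ φ)) (hT.godel (.A13 _ _))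

theorem setOf_imp_mem (hT : IsTheory T) (φ : Formula V) : IsTheory {ψ | imp φ ψ ∈ T} where
  thm h := hT.imp_of_mem (hT.thm h)
  mp {ψ χ} h h' := by
    have h₁ : imp ψ (imp φ χ) ∈ T := hT.mp h' (hT.godel (.A9 _ _ _))
    have h₂ : imp φ (imp φ χ) ∈ T := hT.mp h (hT.mp h₁ (hT.godel (.A8 _ _ _)))
    exact hT.mp h₂ (hT.godel (.A13 _ _))

/-- The deduction theorem, in the form of an introduction rule for implications. -/
theorem imp_mem (hT : IsTheory T) (h : ∀ S, IsTheory S → T ⊆ S → φ ∈ S → ψ ∈ S) :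
    imp φ ψ ∈ T :=
  h _ (hT.setOf_imp_mem φ) (fun _ hχ => hT.imp_of_mem hχ) hT.imp_self

theorem imp_trans (hT : IsTheory T) (h : imp φ ψ ∈ T) (h' : imp ψ χ ∈ T) : imp φ χ ∈ T :=
  hT.mp h (hT.mp h' (hT.godel (.A8 _ _ _)))

theorem and_intro (hT : IsTheory T) (h : φ ∈ T) (h' : ψ ∈ T) : and φ ψ ∈ T :=
  hT.mp h' (hT.mp h (hT.godel (.A4 _ _)))

theorem and_left (hT : IsTheory T) (h : and φ ψ ∈ T) : φ ∈ T := hT.mp h (hT.godel (.A2 _ _))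

theorem and_right (hT : IsTheory T) (h : and φ ψ ∈ T) : ψ ∈ T := hT.mp h (hT.godel (.A3 _ _))

theorem or_inl (hT : IsTheory T) (h : φ ∈ T) : or φ ψ ∈ T := hT.mp h (hT.godel (.A6 _ _))

theorem or_inr (hT : IsTheory T) (h : ψ ∈ T) : or φ ψ ∈ T := hT.mp h (hT.godel (.A7 _ _))

theorem or_imp (hT : IsTheory T) (h : imp φ χ ∈ T) (h' : imp ψ χ ∈ T) :
    imp (or φ ψ) χ ∈ T :=
  hT.mp (hT.and_intro h h') (hT.godel (.A10 _ _ _))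

theorem bot_imp (hT : IsTheory T) : imp bot φ ∈ T := hT.and_left (hT.godel (.A5 φ))

theorem top_mem (hT : IsTheory T) : (top : Formula V) ∈ T := hT.imp_self

theorem box_imp_box (hT : IsTheory T) (h : box (imp φ ψ) ∈ T) : imp (box φ) (box ψ) ∈ T :=
  hT.mp h (hT.gk (.KBox _ _))

/-- `□⁻¹ T` is a theory. -/
theorem setOf_box_mem (hT : IsTheory T) : IsTheory {φ | box φ ∈ T} where
  thm h := hT.thm (.necBox h)
  mp h h' := hT.mp h (hT.box_imp_box h')

/-- Since `φ → ((φ → ψ) → ψ)` is a theorem, monotonicity of `◇` and the scheme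
`◇(φ → ψ) → (□φ → ◇ψ)` give `□(φ → ψ) → (◇φ → ◇ψ)`. -/
theorem dia_imp_dia (hT : IsTheory T) (h : box (imp φ ψ) ∈ T) : imp (dia φ) (dia ψ) ∈ T := by
  have h₁ : GKcDerivable ∅ (imp φ (imp (imp φ ψ) ψ)) :=
    isTheory_theorems.imp_mem fun S hS _ h => hS.imp_mem fun S' hS' hSS' h' =>
      hS'.mp (hSS' h) h'
  exact hT.imp_mem fun S hS hTS hφ => hS.mp (hTS h)
    (hS.mp (hS.mp hφ (hS.thm (.necDia h₁))) (hS.gk (.FS1 _ _)))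

end IsTheory

/-- A prime theory: a proper theory with the disjunction property. -/
structure IsPrimeTheory (T : Set (Formula V)) : Prop extends IsTheory T where
  bot_notMem : bot ∉ T
  mem_or_mem : ∀ {φ ψ : Formula V}, or φ ψ ∈ T → φ ∈ T ∨ ψ ∈ T

theorem IsPrimeTheory.imp_total {T : Set (Formula V)} (hT : IsPrimeTheory T)
    (φ ψ : Formula V) : imp φ ψ ∈ T ∨ imp ψ φ ∈ T :=
  hT.mem_or_mem (hT.godel (.A14 φ ψ))

/-- The prime theory theorem, by Zorn's lemma. -/
theorem IsTheory.exists_isPrimeTheory_disjoint {F J : Set (Formula V)} (hF : IsTheory F)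
    (hJ : J.Nonempty) (hor : ∀ φ ∈ J, ∀ ψ ∈ J, or φ ψ ∈ J) (hFJ : Disjoint F J) :
    ∃ G, IsPrimeTheory G ∧ F ⊆ G ∧ Disjoint G J := by
  have hzorn (c : Set (Set (Formula V))) (hc : c ⊆ {G | IsTheory G ∧ Disjoint G J})
      (hchain : IsChain (· ⊆ ·) c) (hne : c.Nonempty) :
      ∃ G ∈ {G | IsTheory G ∧ Disjoint G J}, ∀ s ∈ c, s ⊆ G := by
    refine ⟨⋃₀ c, ⟨⟨?_, ?_⟩, ?_⟩, fun s hs => Set.subset_sUnion_of_mem hs⟩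
    · obtain ⟨s, hs⟩ := hne
      exact fun h => ⟨s, hs, (hc hs).1.thm h⟩
    · rintro φ ψ ⟨s, hs, hφ⟩ ⟨t, ht, hψ⟩
      rcases hchain.total hs ht with h | h
      · exact ⟨t, ht, (hc ht).1.mp (h hφ) hψ⟩
      · exact ⟨s, hs, (hc hs).1.mp hφ (h hψ)⟩
    · exact Set.disjoint_sUnion_left.2 fun s hs => (hc hs).2
  obtain ⟨G, hFG, ⟨hGt, hGJ⟩, hmax⟩ := zorn_subset_nonempty _ hzorn F ⟨hF, hFJ⟩
  -- If `φ ∉ G`, the theory generated by `G` and `φ` meets `J`.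
  have hcond φ (hφ : φ ∉ G) : ∃ δ ∈ J, imp φ δ ∈ G := by
    by_contra! hcon
    exact hφ (hmax (y := {ψ | imp φ ψ ∈ G})
      ⟨hGt.setOf_imp_mem φ, Set.disjoint_left.2 fun δ h h' => hcon δ h' h⟩
      (fun ψ hψ => hGt.imp_of_mem hψ) hGt.imp_self)
  refine ⟨G, ⟨hGt, fun hbot => ?_, fun {φ ψ} h => ?_⟩, hFG, hGJ⟩
  · obtain ⟨δ, hδ⟩ := hJ
    exact Set.disjoint_left.1 hGJ (hGt.mp hbot hGt.bot_imp) hδ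
  · by_contra! hcon
    obtain ⟨δ, hδ, h₁⟩ := hcond φ hcon.1
    obtain ⟨ε, hε, h₂⟩ := hcond ψ hcon.2
    exact Set.disjoint_left.1 hGJ (hGt.mp h (hGt.or_imp
      (hGt.imp_trans h₁ (hGt.godel (.A6 _ _))) (hGt.imp_trans h₂ (hGt.godel (.A7 _ _)))))
      (hor δ hδ ε hε)

/-- The successors of a prime theory `T` in the canonical frame are the prime theories `G` with
`□⁻¹ T ⊆ G ⊆ ◇⁻¹ T`. -/
structure IsSuccessor (T G : Set (Formula V)) : Prop where
  prime : IsPrimeTheory G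
  mem_of_box : ∀ {φ}, box φ ∈ T → φ ∈ G
  dia_of_mem : ∀ {φ}, φ ∈ G → dia φ ∈ T

/-- If no `□α` with `α` in the directed set `A` belongs to `T`, some successor of `T` omits all
of `A`. The scheme `□(α ∨ γ) → □α ∨ ◇γ` is what allows omitting `A` and the formulas `γ` with
`◇γ ∉ T` at the same time. -/
theorem IsPrimeTheory.exists_isSuccessor_disjoint {T A : Set (Formula V)}
    (hT : IsPrimeTheory T) (hne : A.Nonempty)
    (hdir : ∀ α ∈ A, ∀ β ∈ A, ∃ γ ∈ A, GKcDerivable ∅ (imp (or α β) γ))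
    (hA : ∀ α ∈ A, box α ∉ T) :
    ∃ G, IsSuccessor T G ∧ Disjoint G A := by
  have hF := hT.setOf_box_mem
  let J : Set (Formula V) :=
    {δ | ∃ α ∈ A, ∃ γ, dia γ ∉ T ∧ imp δ (or α γ) ∈ {φ | box φ ∈ T}}
  have hbot : dia (bot : Formula V) ∉ T := fun h => hT.bot_notMem (hT.mp h (hT.gk .FDia))
  have hAJ α (h : α ∈ A) : α ∈ J := ⟨α, h, bot, hbot, hF.godel (.A6 _ _)⟩
  have hor : ∀ δ ∈ J, ∀ δ' ∈ J, or δ δ' ∈ J := by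
    rintro δ ⟨α, hα, γ, hγ, h⟩ δ' ⟨α', hα', γ', hγ', h'⟩
    obtain ⟨β, hβ, hαβ⟩ := hdir α hα α' hα'
    refine ⟨β, hβ, or γ γ', fun hor => ?_, hF.or_imp (hF.imp_trans h (hF.or_imp ?_ ?_))
      (hF.imp_trans h' (hF.or_imp ?_ ?_))⟩
    · exact (hT.mem_or_mem (hT.mp hor (hT.gk (.KDia _ _)))).elim hγ hγ'
    · exact hF.imp_mem fun S hS _ hm => hS.or_inl (hS.mp (hS.or_inl hm) (hS.thm hαβ))
    · exact hF.imp_mem fun S hS _ hm => hS.or_inr (hS.or_inl hm)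
    · exact hF.imp_mem fun S hS _ hm => hS.or_inl (hS.mp (hS.or_inr hm) (hS.thm hαβ))
    · exact hF.imp_mem fun S hS _ hm => hS.or_inr (hS.or_inr hm)
  have hFJ : Disjoint {φ | box φ ∈ T} J := by
    rw [Set.disjoint_left]
    rintro δ hδ ⟨α, hα, γ, hγ, h⟩
    exact (hT.mem_or_mem (hT.mp (hF.mp hδ h) (hT.thm (.cr _ _)))).elim (hA α hα) hγ
  obtain ⟨G, hG, hFG, hGJ⟩ := hF.exists_isPrimeTheory_disjoint (hne.mono hAJ) hor hFJ
  refine ⟨G, ⟨hG, fun h => hFG h, fun {φ} h => ?_⟩, hGJ.mono_right hAJ⟩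
  by_contra hφ
  obtain ⟨α, hα⟩ := hne
  exact Set.disjoint_left.1 hGJ h ⟨α, hα, φ, hφ, hF.godel (.A7 _ _)⟩

/-- Refutation of `□φ`: some successor `G` preserves the position of `φ` below every `θ` with
`□θ` strictly above `□φ`. -/
theorem IsPrimeTheory.exists_isSuccessor_box {T : Set (Formula V)} (hT : IsPrimeTheory T)
    {φ : Formula V} (hφ : box φ ∉ T) :
    ∃ G, IsSuccessor T G ∧ ∀ θ, imp θ φ ∈ G → imp (box θ) (box φ) ∈ T := by
  suffices ∃ G, IsSuccessor T G ∧ Disjoint G {α | ∃ θ, α = imp θ φ ∧ imp (box θ) (box φ) ∉ T} by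
    obtain ⟨G, hG, hGA⟩ := this
    refine ⟨G, hG, fun θ hθ => ?_⟩
    by_contra h
    exact Set.disjoint_left.1 hGA hθ ⟨θ, rfl, h⟩
  refine hT.exists_isSuccessor_disjoint ?_ ?_ ?_
  · exact ⟨_, top, rfl, fun h => hφ (hT.mp (hT.setOf_box_mem.top_mem) h)⟩
  · rintro _ ⟨θ, rfl, hθ⟩ _ ⟨θ', rfl, hθ'⟩
    refine ⟨_, ⟨and θ θ', rfl, fun h => ?_⟩, ?_⟩
    · rcases hT.imp_total (box θ) (box θ') with h' | h'
      · exact hθ (hT.imp_mem fun S hS hTS hm => hS.mp (hS.setOf_box_mem.and_intro hm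
          (hS.mp hm (hTS h'))) (hTS h))
      · exact hθ' (hT.imp_mem fun S hS hTS hm => hS.mp (hS.setOf_box_mem.and_intro
          (hS.mp hm (hTS h')) hm) (hTS h))
    · exact isTheory_theorems.or_imp
        (isTheory_theorems.imp_mem fun S hS _ hm => hS.imp_mem fun S' hS' hSS' hm' =>
          hS'.mp (hS'.and_left hm') (hSS' hm))
        (isTheory_theorems.imp_mem fun S hS _ hm => hS.imp_mem fun S' hS' hSS' hm' =>
          hS'.mp (hS'.and_right hm') (hSS' hm))
  · rintro _ ⟨θ, rfl, hθ⟩ h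
    exact hθ (hT.box_imp_box h)

/-- Witness for `◇φ`: some successor `G` preserves the position of `φ` above every `θ` with
`◇θ` strictly below `◇φ`. -/
theorem IsPrimeTheory.exists_isSuccessor_dia {T : Set (Formula V)} (hT : IsPrimeTheory T)
    {φ : Formula V} (hφ : neg (dia φ) ∉ T) :
    ∃ G, IsSuccessor T G ∧ ∀ θ, imp φ θ ∈ G → imp (dia φ) (dia θ) ∈ T := by
  suffices ∃ G, IsSuccessor T G ∧ Disjoint G {α | ∃ θ, α = imp φ θ ∧ imp (dia φ) (dia θ) ∉ T} by
    obtain ⟨G, hG, hGA⟩ := this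
    refine ⟨G, hG, fun θ hθ => ?_⟩
    by_contra h
    exact Set.disjoint_left.1 hGA hθ ⟨θ, rfl, h⟩
  refine hT.exists_isSuccessor_disjoint ?_ ?_ ?_
  · exact ⟨_, bot, rfl, fun h => hφ (hT.imp_trans h (hT.gk .FDia))⟩
  · rintro _ ⟨θ, rfl, hθ⟩ _ ⟨θ', rfl, hθ'⟩
    refine ⟨_, ⟨or θ θ', rfl, fun h => ?_⟩, ?_⟩
    · have h := hT.imp_trans h (hT.gk (.KDia _ _))
      rcases hT.imp_total (dia θ) (dia θ') with h' | h'
      · exact hθ' (hT.imp_trans h (hT.or_imp h' hT.imp_self))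
      · exact hθ (hT.imp_trans h (hT.or_imp hT.imp_self h'))
    · exact isTheory_theorems.or_imp
        (isTheory_theorems.imp_mem fun S hS _ hm => hS.imp_trans hm (hS.godel (.A6 _ _)))
        (isTheory_theorems.imp_mem fun S hS _ hm => hS.imp_trans hm (hS.godel (.A7 _ _)))
  · rintro _ ⟨θ, rfl, hθ⟩ h
    exact hθ (hT.dia_imp_dia h)

/-! ### The canonical model over a finite fragment -/

/-- A set of formulas that is closed under subformulas and contains `⊤`, `□⊤` and `◇⊥`. The last
two make the value `1` of `⊤` and the value `0` of `⊥` at a successor instances of the bounds that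
the boxed and diamond formulas impose. -/
structure IsFragment (S : Set (Formula V)) : Prop where
  top_mem : top ∈ S
  box_top_mem : box top ∈ S
  dia_bot_mem : dia bot ∈ S
  and_mem : ∀ {φ ψ : Formula V}, and φ ψ ∈ S → φ ∈ S ∧ ψ ∈ S
  or_mem : ∀ {φ ψ : Formula V}, or φ ψ ∈ S → φ ∈ S ∧ ψ ∈ S
  imp_mem : ∀ {φ ψ}, imp φ ψ ∈ S → φ ∈ S ∧ ψ ∈ S
  box_mem : ∀ {φ}, box φ ∈ S → φ ∈ S
  dia_mem : ∀ {φ}, dia φ ∈ S → φ ∈ S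

theorem IsFragment.bot_mem {S : Set (Formula V)} (hS : IsFragment S) : bot ∈ S :=
  hS.dia_mem hS.dia_bot_mem

theorem IsFragment.union {S S' : Set (Formula V)} (hS : IsFragment S) (hS' : IsFragment S') :
    IsFragment (S ∪ S') where
  top_mem := .inl hS.top_mem
  box_top_mem := .inl hS.box_top_mem
  dia_bot_mem := .inl hS.dia_bot_mem
  and_mem h := h.elim (fun h => (hS.and_mem h).imp .inl .inl)
    fun h => (hS'.and_mem h).imp .inr .inr
  or_mem h := h.elim (fun h => (hS.or_mem h).imp .inl .inl)
    fun h => (hS'.or_mem h).imp .inr .inr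
  imp_mem h := h.elim (fun h => (hS.imp_mem h).imp .inl .inl)
    fun h => (hS'.imp_mem h).imp .inr .inr
  box_mem h := h.imp hS.box_mem hS'.box_mem
  dia_mem h := h.imp hS.dia_mem hS'.dia_mem

theorem exists_isFragment_mem (φ : Formula V) : ∃ S, S.Finite ∧ IsFragment S ∧ φ ∈ S := by
  have base : IsFragment ({bot, top, box top, dia bot} : Set (Formula V)) := by
    constructor <;> simp [top]
  have base_fin : ({bot, top, box top, dia bot} : Set (Formula V)).Finite := Set.toFinite _
  induction φ with
  | bot => exact ⟨_, base_fin, base, by simp⟩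
  | var p =>
    refine ⟨_, base_fin.insert (var p), ?_, Set.mem_insert _ _⟩
    constructor <;> simp [top]
  | and φ ψ ihφ ihψ =>
    obtain ⟨S, hf, hS, hφ⟩ := ihφ
    obtain ⟨S', hf', hS', hψ⟩ := ihψ
    obtain ⟨h₁, h₂, h₃, h₄, h₅, h₆, h₇, h₈⟩ := hS.union hS'
    refine ⟨_, (hf.union hf').insert (and φ ψ), ?_, Set.mem_insert _ _⟩
    constructor <;> grind
  | or φ ψ ihφ ihψ =>
    obtain ⟨S, hf, hS, hφ⟩ := ihφ
    obtain ⟨S', hf', hS', hψ⟩ := ihψ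
    obtain ⟨h₁, h₂, h₃, h₄, h₅, h₆, h₇, h₈⟩ := hS.union hS'
    refine ⟨_, (hf.union hf').insert (or φ ψ), ?_, Set.mem_insert _ _⟩
    constructor <;> grind
  | imp φ ψ ihφ ihψ =>
    obtain ⟨S, hf, hS, hφ⟩ := ihφ
    obtain ⟨S', hf', hS', hψ⟩ := ihψ
    obtain ⟨h₁, h₂, h₃, h₄, h₅, h₆, h₇, h₈⟩ := hS.union hS'
    refine ⟨_, (hf.union hf').insert (imp φ ψ), ?_, Set.mem_insert _ _⟩
    constructor <;> grind
  | box φ ih =>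
    obtain ⟨S, hf, ⟨h₁, h₂, h₃, h₄, h₅, h₆, h₇, h₈⟩, hφ⟩ := ih
    refine ⟨_, hf.insert (box φ), ?_, Set.mem_insert _ _⟩
    constructor <;> grind
  | dia φ ih =>
    obtain ⟨S, hf, ⟨h₁, h₂, h₃, h₄, h₅, h₆, h₇, h₈⟩, hφ⟩ := ih
    refine ⟨_, hf.insert (dia φ), ?_, Set.mem_insert _ _⟩
    constructor <;> grind

/-- `e` realizes, on the fragment `S`, the linear order that the prime theory `T` induces on
formulas, with the extreme values at `⊥` and `⊤`. Values outside `S` are normalized to `0`. -/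
structure Realizes (S T : Set (Formula V)) (e : Formula V → unitInterval) : Prop where
  le_iff : ∀ {φ ψ}, φ ∈ S → ψ ∈ S → (e φ ≤ e ψ ↔ imp φ ψ ∈ T)
  map_bot : e bot = 0
  map_top : e top = 1
  eq_zero : ∀ {φ}, φ ∉ S → e φ = 0

namespace Realizes

variable {S T : Set (Formula V)} {e : Formula V → unitInterval} {φ ψ : Formula V}

theorem eq_one_iff (he : Realizes S T e) (hS : IsFragment S) (hT : IsTheory T) (hφ : φ ∈ S) :
    e φ = 1 ↔ φ ∈ T := by
  rw [← unitInterval.le_one'.ge_iff_eq, ← he.map_top, he.le_iff hS.top_mem hφ]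
  exact ⟨hT.mp hT.top_mem, hT.imp_of_mem⟩

theorem eq_zero_iff (he : Realizes S T e) (hS : IsFragment S) (hφ : φ ∈ S) :
    e φ = 0 ↔ neg φ ∈ T := by
  rw [← unitInterval.nonneg'.ge_iff_eq', ← he.map_bot, he.le_iff hφ hS.bot_mem, neg]

theorem eval_and (he : Realizes S T e) (hS : IsFragment S) (hT : IsTheory T)
    (h : and φ ψ ∈ S) : e (and φ ψ) = min (e φ) (e ψ) := by
  obtain ⟨hφ, hψ⟩ := hS.and_mem h
  refine le_antisymm (le_min ((he.le_iff h hφ).2 (hT.godel (.A2 _ _)))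
    ((he.le_iff h hψ).2 (hT.godel (.A3 _ _)))) ?_
  rcases le_total (e φ) (e ψ) with hle | hle
  · rw [min_eq_left hle, he.le_iff hφ h]
    exact hT.mp (hT.and_intro hT.imp_self ((he.le_iff hφ hψ).1 hle)) (hT.godel (.A12 _ _ _))
  · rw [min_eq_right hle, he.le_iff hψ h]
    exact hT.mp (hT.and_intro ((he.le_iff hψ hφ).1 hle) hT.imp_self) (hT.godel (.A12 _ _ _))

theorem eval_or (he : Realizes S T e) (hS : IsFragment S) (hT : IsTheory T)
    (h : or φ ψ ∈ S) : e (or φ ψ) = max (e φ) (e ψ) := by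
  obtain ⟨hφ, hψ⟩ := hS.or_mem h
  refine le_antisymm ?_ (max_le ((he.le_iff hφ h).2 (hT.godel (.A6 _ _)))
    ((he.le_iff hψ h).2 (hT.godel (.A7 _ _))))
  rcases le_total (e φ) (e ψ) with hle | hle
  · rw [max_eq_right hle, he.le_iff h hψ]
    exact hT.or_imp ((he.le_iff hφ hψ).1 hle) hT.imp_self
  · rw [max_eq_left hle, he.le_iff h hφ]
    exact hT.or_imp hT.imp_self ((he.le_iff hψ hφ).1 hle)

theorem eval_imp (he : Realizes S T e) (hS : IsFragment S) (hT : IsPrimeTheory T)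
    (h : imp φ ψ ∈ S) : e (imp φ ψ) = godelImp (e φ) (e ψ) := by
  obtain ⟨hφ, hψ⟩ := hS.imp_mem h
  unfold godelImp
  split_ifs with hle
  · rw [he.eq_one_iff hS hT.toIsTheory h]
    exact (he.le_iff hφ hψ).1 hle
  · have hnot : imp φ ψ ∉ T := fun hm => hle ((he.le_iff hφ hψ).2 hm)
    refine le_antisymm ((he.le_iff h hψ).2 ?_) ((he.le_iff hψ h).2 (hT.godel (.A1 _ _)))
    rcases hT.imp_total (imp φ ψ) φ with h' | h'
    · exact hT.imp_mem fun U hU hTU hm => hU.mp (hU.mp hm (hTU h')) hm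
    · exact absurd (hT.mp h' (hT.godel (.A13 _ _))) hnot

end Realizes

/-- The order that a prime theory induces on a finite fragment is realized by a valuation between
any bounds compatible with that order. -/
theorem IsPrimeTheory.exists_realizes {S G : Set (Formula V)} (hfin : S.Finite)
    (hS : IsFragment S) (hG : IsPrimeTheory G) (l u : Formula V → unitInterval)
    (hle : ∀ a ∈ S, ∀ b ∈ S, imp a b ∈ G → l a ≤ u b)
    (hlt : ∀ a ∈ S, ∀ b ∈ S, imp b a ∉ G → l a < u b) (htop : l top = 1) (hbot : u bot = 0) :
    ∃ e, Realizes S G e ∧ ∀ a ∈ S, l a ≤ e a ∧ e a ≤ u a := by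
  classical
  have : Finite S := hfin
  obtain ⟨e, he, hb⟩ := exists_orderEmbedding_between (α := S)
    (fun a b => imp (a : Formula V) b ∈ G) (fun a b => hG.imp_total a b)
    (fun _ _ _ => hG.imp_trans) (fun a => l a) (fun a => u a)
    (fun a b => hle a a.2 b b.2) (fun a b => hlt a a.2 b b.2)
  let e' : Formula V → unitInterval := fun φ => if h : φ ∈ S then e ⟨φ, h⟩ else 0
  have he' {φ} (h : φ ∈ S) : e' φ = e ⟨φ, h⟩ := dif_pos h
  have hb' a (ha : a ∈ S) : l a ≤ e' a ∧ e' a ≤ u a := by rw [he' ha]; exact hb ⟨a, ha⟩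
  refine ⟨e', ⟨fun h h' => by rw [he' h, he' h', he], ?_, ?_, fun h => dif_neg h⟩, hb'⟩
  · exact le_antisymm ((hb' _ hS.bot_mem).2.trans_eq hbot) unitInterval.nonneg'
  · exact le_antisymm unitInterval.le_one' (htop.ge.trans (hb' _ hS.top_mem).1)

open Classical in
/-- The lower bound that a world with valuation `e` imposes on the values at its successors. -/
noncomputable def boxBound (S : Set (Formula V)) (e : Formula V → unitInterval)
    (ψ : Formula V) : unitInterval := if box ψ ∈ S then e (box ψ) else 0

open Classical in
/-- The upper bound that a world with valuation `e` imposes on the values at its successors. -/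
noncomputable def diaBound (S : Set (Formula V)) (e : Formula V → unitInterval)
    (ψ : Formula V) : unitInterval := if dia ψ ∈ S then e (dia ψ) else 1

section Bounds

variable {S T G : Set (Formula V)} {e : Formula V → unitInterval} {φ a b : Formula V}

theorem boxBound_of_mem (h : box φ ∈ S) : boxBound S e φ = e (box φ) := if_pos h

theorem boxBound_of_notMem (h : box φ ∉ S) : boxBound S e φ = 0 := if_neg h

theorem diaBound_of_mem (h : dia φ ∈ S) : diaBound S e φ = e (dia φ) := if_pos h

theorem diaBound_of_notMem (h : dia φ ∉ S) : diaBound S e φ = 1 := if_neg h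

theorem Realizes.boxBound_top (he : Realizes S T e) (hS : IsFragment S) (hT : IsTheory T) :
    boxBound S e top = 1 := by
  rw [boxBound_of_mem hS.box_top_mem, he.eq_one_iff hS hT hS.box_top_mem]
  exact hT.setOf_box_mem.top_mem

theorem Realizes.diaBound_bot (he : Realizes S T e) (hS : IsFragment S) (hT : IsTheory T) :
    diaBound S e bot = 0 := by
  rw [diaBound_of_mem hS.dia_bot_mem, he.eq_zero_iff hS hS.dia_bot_mem]
  exact hT.gk .FDia

/-- Consistency of the bounds at equivalent formulas, from `◇(φ → ψ) → (□φ → ◇ψ)`. -/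
theorem Realizes.boxBound_le_diaBound (he : Realizes S T e) (hT : IsPrimeTheory T)
    (hG : IsSuccessor T G) (h : imp a b ∈ G) : boxBound S e a ≤ diaBound S e b := by
  by_cases ha : box a ∈ S
  · by_cases hb : dia b ∈ S
    · rw [boxBound_of_mem ha, diaBound_of_mem hb, he.le_iff ha hb]
      exact hT.mp (hG.dia_of_mem h) (hT.gk (.FS1 _ _))
    · exact (diaBound_of_notMem hb).symm ▸ unitInterval.le_one'
  · exact (boxBound_of_notMem ha).symm ▸ unitInterval.nonneg'

/-- Room between the bounds at strictly ordered formulas, from `(◇φ → □ψ) → □(φ → ψ)`. -/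
theorem Realizes.boxBound_lt_diaBound (he : Realizes S T e) (hS : IsFragment S)
    (hT : IsPrimeTheory T) (hG : IsSuccessor T G) (h : imp b a ∉ G) :
    boxBound S e a < diaBound S e b := by
  contrapose! h
  suffices imp (dia b) (box a) ∈ T ∨ a ∈ G from
    this.elim (fun h => hG.mem_of_box (hT.mp h (hT.gk (.FS2 _ _)))) hG.prime.imp_of_mem
  by_cases hb : dia b ∈ S
  · rw [diaBound_of_mem hb] at h
    left
    by_cases ha : box a ∈ S
    · rwa [boxBound_of_mem ha, he.le_iff hb ha] at h
    · rw [boxBound_of_notMem ha, unitInterval.nonneg'.ge_iff_eq', he.eq_zero_iff hS hb] at h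
      exact hT.imp_trans h hT.bot_imp
  · rw [diaBound_of_notMem hb, unitInterval.le_one'.ge_iff_eq] at h
    right
    by_cases ha : box a ∈ S
    · rw [boxBound_of_mem ha, he.eq_one_iff hS hT.toIsTheory ha] at h
      exact hG.mem_of_box h
    · exact absurd (h.symm.trans (boxBound_of_notMem ha)) one_ne_zero

end Bounds

/-- The worlds of the canonical model over `S`. -/
def World (S : Set (Formula V)) : Type u :=
  {e : Formula V → unitInterval // ∃ T, IsPrimeTheory T ∧ Realizes S T e}

/-- The worlds are determined by their values on a finite set, so they fit into any universe. -/
theorem small_world {S : Set (Formula V)} (hfin : S.Finite) : Small.{v} (World S) := by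
  have : Finite S := hfin
  refine small_of_injective (β := S → unitInterval) (f := fun x φ => x.1 φ) ?_
  rintro ⟨e, T, hT, he⟩ ⟨e', T', hT', he'⟩ h
  refine Subtype.ext (funext fun φ => ?_)
  by_cases hφ : φ ∈ S
  · exact congrFun h ⟨φ, hφ⟩
  · exact (he.eq_zero hφ).trans (he'.eq_zero hφ).symm

/-- `f` is a possible valuation at a successor of a world with valuation `e`. -/
def Accessible (S : Set (Formula V)) (e f : Formula V → unitInterval) : Prop :=
  ∀ ψ, (box ψ ∈ S → e (box ψ) ≤ f ψ) ∧ (dia ψ ∈ S → f ψ ≤ e (dia ψ))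

section Successors

variable {S T : Set (Formula V)} {e : Formula V → unitInterval} {φ : Formula V}

theorem accessible_of_bounds {f : Formula V → unitInterval} (hS : IsFragment S)
    (h : ∀ a ∈ S, boxBound S e a ≤ f a ∧ f a ≤ diaBound S e a) : Accessible S e f :=
  fun _ => ⟨fun hψ => boxBound_of_mem (e := e) hψ ▸ (h _ (hS.box_mem hψ)).1,
    fun hψ => diaBound_of_mem (e := e) hψ ▸ (h _ (hS.dia_mem hψ)).2⟩

/-- The infimum over the successors does not exceed `e (□φ)`: in a successor theory given by
`IsPrimeTheory.exists_isSuccessor_box`, the additional bound `β` at `φ` is compatible with the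
bounds coming from `e`. The infimum need not be attained. -/
theorem Realizes.exists_accessible_le (he : Realizes S T e) (hfin : S.Finite)
    (hS : IsFragment S) (hT : IsPrimeTheory T) (hφ : box φ ∈ S) {β : unitInterval}
    (hβ : e (box φ) < β) : ∃ f : World S, Accessible S e f.1 ∧ f.1 φ ≤ β := by
  classical
  have hbox : box φ ∉ T := by
    rw [← he.eq_one_iff hS hT.toIsTheory hφ]
    exact (hβ.trans_le unitInterval.le_one').ne
  obtain ⟨G, hG, hGφ⟩ := hT.exists_isSuccessor_box hbox
  have hlow a (h : imp a φ ∈ G) : boxBound S e a < β := by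
    refine lt_of_le_of_lt ?_ hβ
    by_cases ha : box a ∈ S
    · rw [boxBound_of_mem ha, he.le_iff ha hφ]
      exact hGφ a h
    · exact (boxBound_of_notMem ha).symm ▸ unitInterval.nonneg'
  obtain ⟨f, hf, hb⟩ := hG.prime.exists_realizes hfin hS (boxBound S e)
    (fun a => min (diaBound S e a) (if a = φ then β else 1))
    (fun a _ b _ h => by
      refine le_min (he.boxBound_le_diaBound hT hG h) ?_
      split_ifs with hb
      · exact (hlow a (hb ▸ h)).le
      · exact unitInterval.le_one')
    (fun a _ b _ h => by
      have hab := he.boxBound_lt_diaBound hS hT hG h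
      refine lt_min hab ?_
      split_ifs with hb
      · exact hlow a (hb ▸ (hG.prime.imp_total _ _).resolve_left h)
      · exact hab.trans_le unitInterval.le_one')
    (he.boxBound_top hS hT.toIsTheory)
    (by rw [he.diaBound_bot hS hT.toIsTheory, min_eq_left unitInterval.nonneg'])
  refine ⟨⟨f, G, hG.prime, hf⟩, accessible_of_bounds hS fun a ha =>
    ⟨(hb a ha).1, (hb a ha).2.trans (min_le_left _ _)⟩, ?_⟩
  simpa using ((hb φ (hS.box_mem hφ)).2.trans (min_le_right _ _))

/-- The supremum over the successors is at least `e (◇φ)`: in a successor theory given by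
`IsPrimeTheory.exists_isSuccessor_dia`, the additional lower bound `β` at `φ` is compatible with
the bounds coming from `e`. -/
theorem Realizes.exists_le_accessible (he : Realizes S T e) (hfin : S.Finite)
    (hS : IsFragment S) (hT : IsPrimeTheory T) (hφ : dia φ ∈ S) {β : unitInterval}
    (hβ : β < e (dia φ)) : ∃ f : World S, Accessible S e f.1 ∧ β ≤ f.1 φ := by
  classical
  have hdia : neg (dia φ) ∉ T := by
    rw [← he.eq_zero_iff hS hφ]
    exact (unitInterval.nonneg'.trans_lt hβ).ne'
  obtain ⟨G, hG, hGφ⟩ := hT.exists_isSuccessor_dia hdia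
  have hupp b (h : imp φ b ∈ G) : β < diaBound S e b := by
    refine lt_of_lt_of_le hβ ?_
    by_cases hb : dia b ∈ S
    · rw [diaBound_of_mem hb, he.le_iff hφ hb]
      exact hGφ b h
    · exact (diaBound_of_notMem hb).symm ▸ unitInterval.le_one'
  obtain ⟨f, hf, hb⟩ := hG.prime.exists_realizes hfin hS
    (fun a => max (boxBound S e a) (if a = φ then β else 0)) (diaBound S e)
    (fun a _ b _ h => by
      refine max_le (he.boxBound_le_diaBound hT hG h) ?_
      split_ifs with ha
      · exact (hupp b (ha ▸ h)).le
      · exact unitInterval.nonneg')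
    (fun a _ b _ h => by
      have hab := he.boxBound_lt_diaBound hS hT hG h
      refine max_lt hab ?_
      split_ifs with ha
      · exact hupp b (ha ▸ (hG.prime.imp_total _ _).resolve_left h)
      · exact unitInterval.nonneg'.trans_lt hab)
    (by rw [he.boxBound_top hS hT.toIsTheory, max_eq_left unitInterval.le_one'])
    (he.diaBound_bot hS hT.toIsTheory)
  refine ⟨⟨f, G, hG.prime, hf⟩, accessible_of_bounds hS fun a ha =>
    ⟨(le_max_left _ _).trans (hb a ha).1, (hb a ha).2⟩, ?_⟩
  simpa using ((le_max_right _ _).trans (hb φ (hS.dia_mem hφ)).1)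

end Successors

open Classical in
/-- The canonical model over `S`, with its type of worlds shrunk to the universe `v`. -/
noncomputable def canonicalModel (S : Set (Formula V)) [Small.{v} (World S)]
    (h : Nonempty (World S)) : GKModel.{u, v} V where
  W := Shrink.{v} (World S)
  nonempty := h.map (equivShrink _)
  R x y := if Accessible S ((equivShrink _).symm x).1 ((equivShrink _).symm y).1 then 1 else 0
  e p x := ((equivShrink _).symm x).1 (var p)

section CanonicalModel

variable {S : Set (Formula V)} [Small.{v} (World S)] (h : Nonempty (World S))

theorem isCrisp_canonicalModel : (canonicalModel.{u, v} S h).IsCrisp := by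
  intro x y
  simp only [canonicalModel]
  split_ifs <;> simp

theorem canonicalModel_R_eq_one (x y : World S) :
    (canonicalModel.{u, v} S h).R (equivShrink _ x) (equivShrink _ y) = 1 ↔
      Accessible S x.1 y.1 := by
  simp [canonicalModel]

/-- The truth lemma. -/
theorem eval_canonicalModel (hfin : S.Finite) (hS : IsFragment S) {φ : Formula V} (hφ : φ ∈ S)
    (x : World S) : (canonicalModel.{u, v} S h).eval (equivShrink _ x) φ = x.1 φ := by
  obtain ⟨T, hT, he⟩ := x.2
  have hcrisp := isCrisp_canonicalModel.{u, v} h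
  induction φ generalizing x T with
  | var p => simp [GKModel.eval, canonicalModel]
  | bot => exact he.map_bot.symm
  | and φ ψ ihφ ihψ =>
    exact (congrArg₂ min (ihφ (hS.and_mem hφ).1 x T hT he)
      (ihψ (hS.and_mem hφ).2 x T hT he)).trans (he.eval_and hS hT.toIsTheory hφ).symm
  | or φ ψ ihφ ihψ =>
    exact (congrArg₂ max (ihφ (hS.or_mem hφ).1 x T hT he)
      (ihψ (hS.or_mem hφ).2 x T hT he)).trans (he.eval_or hS hT.toIsTheory hφ).symm
  | imp φ ψ ihφ ihψ =>
    exact (congrArg₂ godelImp (ihφ (hS.imp_mem hφ).1 x T hT he)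
      (ihψ (hS.imp_mem hφ).2 x T hT he)).trans (he.eval_imp hS hT hφ).symm
  | box φ ih =>
    have ih (y : World S) : (canonicalModel.{u, v} S h).eval (equivShrink _ y) φ = y.1 φ :=
      y.2.elim fun T' h' => ih (hS.box_mem hφ) y T' h'.1 h'.2
    refine le_antisymm (le_of_forall_gt_imp_ge_of_dense fun β hβ => ?_)
      (hcrisp.le_eval_box.2 fun y hy => ?_)
    · obtain ⟨f, hf, hfβ⟩ := he.exists_accessible_le hfin hS hT hφ hβ
      rw [← ih f] at hfβ
      exact (hcrisp.le_eval_box.1 le_rfl _ ((canonicalModel_R_eq_one h x f).2 hf)).trans hfβ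
    · obtain ⟨y, rfl⟩ := (equivShrink (World S)).surjective y
      rw [ih]
      exact (((canonicalModel_R_eq_one h x y).1 hy) φ).1 hφ
  | dia φ ih =>
    have ih (y : World S) : (canonicalModel.{u, v} S h).eval (equivShrink _ y) φ = y.1 φ :=
      y.2.elim fun T' h' => ih (hS.dia_mem hφ) y T' h'.1 h'.2
    refine le_antisymm (hcrisp.eval_dia_le.2 fun y hy => ?_)
      (le_of_forall_lt_imp_le_of_dense fun β hβ => ?_)
    · obtain ⟨y, rfl⟩ := (equivShrink (World S)).surjective y
      rw [ih]
      exact (((canonicalModel_R_eq_one h x y).1 hy) φ).2 hφ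
    · obtain ⟨f, hf, hfβ⟩ := he.exists_le_accessible hfin hS hT hφ hβ
      rw [← ih f] at hfβ
      exact hfβ.trans (hcrisp.eval_dia_le.1 le_rfl _ ((canonicalModel_R_eq_one h x f).2 hf))

end CanonicalModel

/-! ### Completeness -/

theorem exists_isPrimeTheory_notMem {φ : Formula V} (h : ¬ GKcDerivable ∅ φ) :
    ∃ G, IsPrimeTheory G ∧ φ ∉ G := by
  have hthm := isTheory_theorems (V := V)
  obtain ⟨G, hG, -, hd⟩ := hthm.exists_isPrimeTheory_disjoint
    (J := {δ | GKcDerivable ∅ (imp δ φ)}) ⟨φ, hthm.imp_self⟩ (fun _ h₁ _ h₂ => hthm.or_imp h₁ h₂)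
    (Set.disjoint_left.2 fun _ h₁ h₂ => h (hthm.mp h₁ h₂))
  exact ⟨G, hG, fun hm => Set.disjoint_left.1 hd hm hthm.imp_self⟩

/-- Without further bounds, every prime theory is realized. The bounds used here only place `1` at
the elements of `G` and `0` at the formulas whose negation is in `G`. -/
theorem IsPrimeTheory.exists_realizes_self {S G : Set (Formula V)} (hG : IsPrimeTheory G)
    (hfin : S.Finite) (hS : IsFragment S) : ∃ e, Realizes S G e := by
  classical
  obtain ⟨e, he, -⟩ := hG.exists_realizes hfin hS (fun a => if a ∈ G then 1 else 0)
    (fun a => if neg a ∈ G then 0 else 1)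
    (fun a _ b _ h => by
      split_ifs with h₁ h₂
      · exact absurd (hG.mp (hG.mp h₁ h) h₂) hG.bot_notMem
      all_goals simp)
    (fun a _ b _ h => by
      rw [if_neg fun ha => h (hG.imp_of_mem ha),
        if_neg fun hb : neg b ∈ G => h (hG.imp_trans hb hG.bot_imp)]
      exact zero_lt_one)
    (if_pos hG.top_mem) (if_pos hG.imp_self)
  exact ⟨e, he⟩

/-- Completeness: an underivable formula fails at a world of the canonical model over a finite
fragment containing it. -/
theorem CrispConsequence.derivable {φ : Formula V} (h : CrispConsequence.{u, v} ∅ φ) :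
    GKcDerivable ∅ φ := by
  by_contra hφ
  obtain ⟨S, hfin, hS, hφS⟩ := exists_isFragment_mem φ
  obtain ⟨G, hG, hφG⟩ := exists_isPrimeTheory_notMem hφ
  obtain ⟨e, he⟩ := hG.exists_realizes_self hfin hS
  have := small_world.{u, v} hfin
  let x : World S := ⟨e, G, hG, he⟩
  have hx := h (canonicalModel.{u, v} S ⟨x⟩) (isCrisp_canonicalModel _) (equivShrink _ x) (by simp)
  rw [eval_canonicalModel _ hfin hS hφS] at hx
  exact hφG ((he.eq_one_iff hS hG.toIsTheory hφS).1 hx)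

end GodelModal

theorem mainTheorem2 {V : Type u} [Countable V] (φ : GodelModal.Formula V) :
    GodelModal.GKcDerivable (∅ : Set (GodelModal.Formula V)) φ ↔
      GodelModal.CrispConsequence.{u, v} (∅ : Set (GodelModal.Formula V)) φ := by
  exact ⟨fun h => h.crispConsequence, fun h => h.derivable⟩
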